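/- A \emph{measure} on $\mathbb R^n$ means a complex, locally finite Borel measure $\mu$ which is slowly increasing, i.e. for some $N$ one has $|\mu|(\{|x|<R\})=O(R^N)$ as $R\to\infty$. For a pure point (purely atomic) measure $\mu$, its \emph{support} is the countable set of its non-zero atoms. Fourier transforms are taken in the sense of temperate distributions, with $\hat\varphi(t)=\int_{\mathbb R^n}\varphi(x)e^{-2\pi i\langle t,x\rangle}\,dx$. For $A\subset\mathbb R^n$ put $d(A)=\inf\{|x-y|: x,y\in A,\ x\ne y\}$ (with $\inf\emptyset=+\infty$); $A$ is \emph{uniformly discrete} if $d(A)>0$, and \emph{relatively dense} if there is $R>0$ such that every ball of radius $R$ intersects $A$. A \emph{Meyer set} is a uniformly discrete and relatively dense set $\Lambda\subset\mathbb R^n$ for which there is a finite set $F$ with $\Lambda-\Lambda\subset\Lambda+F$. \textbf{Theorem.} For every $n$ there is a constant $C>0$, depending on the dimension $n$ only, with the following property. Let $\mu$ be a pure point measure on $\mathbb R^n$ whose Fourier transform $\hat\mu$ is also a pure point (slowly increasing) measure, let $\Lambda$ be the support of $\mu$ and $S$ (the spectrum) the support of $\hat\mu$, and assume that $\Lambda$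 is a Meyer set. Then either $S$ is uniformly discrete, or the set of accumulation points of $S$ in $\mathbb R^n$ is relatively dense. Moreover, if $S$ is not uniformly discrete, then every ball of radius $C/d(\Lambda-\Lambda)$ contains infinitely many points of $S$. -/

import Mathlib

open MeasureTheory Set Filter Topology Metric
open scoped Pointwise FourierTransform SchwartzMap ENNReal

noncomputable section

namespace Quasicrystal

/-- `Λ` is uniformly discrete: `d(Λ) = inf {|x - y| : x, y ∈ Λ, x ≠ y} > 0`, the infimum being
taken in `[0, ∞]`, so that a set with at most one point is uniformly discrete. -/
def IsUniformlyDiscrete {X : Type*} [PseudoEMetricSpace X] (Λ : Set X) : Prop :=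
  0 < Λ.einfsep

/-- `Λ` is relatively dense: for some `R > 0` every ball of radius `R` intersects `Λ`. -/
def IsRelativelyDense {X : Type*} [PseudoMetricSpace X] (Λ : Set X) : Prop :=
  ∃ R : ℝ, 0 < R ∧ ∀ x : X, (ball x R ∩ Λ).Nonempty

/-- A Delone set is a uniformly discrete and relatively dense set. -/
def IsDelone {X : Type*} [PseudoMetricSpace X] (Λ : Set X) : Prop :=
  IsUniformlyDiscrete Λ ∧ IsRelativelyDense Λ

/-- A Meyer set is a Delone set `Λ` with `Λ - Λ ⊆ Λ + F` for some finite set `F`. -/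
def IsMeyer {E : Type*} [SeminormedAddCommGroup E] (Λ : Set E) : Prop :=
  IsDelone Λ ∧ ∃ F : Set E, F.Finite ∧ Λ - Λ ⊆ Λ + F

/-- A complex, locally finite measure `μ` which is slowly increasing, given by its polar
decomposition `dμ = phase d|μ|`: here `var` is the total variation `|μ|`, a positive locally finite
Borel measure with `|μ|(B_R) = O(R ^ N)` for some `N`, and `phase` is a measurable function of
modulus one. -/
structure SlowlyIncreasingMeasure (E : Type*) [NormedAddCommGroup E] [MeasurableSpace E] where
  /-- The total variation measure. -/
  var : Measure E
  /-- The density with respect to the total variation. -/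
  phase : E → ℂ
  locallyFinite : IsLocallyFiniteMeasure var
  growth : ∃ N : ℕ, (fun R : ℝ => var.real (ball (0 : E) R)) =O[atTop] (fun R : ℝ => R ^ N)
  measurable_phase : Measurable phase
  norm_phase : ∀ x, ‖phase x‖ = 1

namespace SlowlyIncreasingMeasure

section Atoms

variable {E : Type*} [NormedAddCommGroup E] [MeasurableSpace E]

/-- The mass `μ({x})` of the point `x`. -/
def atom (μ : SlowlyIncreasingMeasure E) (x : E) : ℂ :=
  (μ.var.real {x} : ℂ) * μ.phase x

/-- The set of the non-zero atoms. -/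
def support (μ : SlowlyIncreasingMeasure E) : Set E :=
  {x | μ.atom x ≠ 0}

/-- The measure is pure point (purely atomic): it is concentrated on a countable set. -/
def IsPurePoint (μ : SlowlyIncreasingMeasure E) : Prop :=
  ∃ A : Set E, A.Countable ∧ μ.var Aᶜ = 0

theorem memLp_phase (μ : SlowlyIncreasingMeasure E) : MemLp μ.phase ∞ μ.var :=
  memLp_top_of_bound μ.measurable_phase.aestronglyMeasurable 1
    (Eventually.of_forall fun x => (μ.norm_phase x).le)

end Atoms

variable {E : Type*} [NormedAddCommGroup E] [InnerProductSpace ℝ E] [FiniteDimensional ℝ E]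
  [MeasurableSpace E] [BorelSpace E]

theorem hasTemperateGrowth (μ : SlowlyIncreasingMeasure E) : μ.var.HasTemperateGrowth := by
  have := μ.locallyFinite
  obtain ⟨N, hN⟩ := μ.growth
  refine ⟨⟨N + 2, ?_⟩⟩
  have hmeas : Measurable (fun x : E => (1 + ‖x‖) ^ (-((N + 2 : ℕ) : ℝ))) := by fun_prop
  refine ⟨hmeas.aestronglyMeasurable, ?_⟩
  have hlt : ∀ x : E, ‖x‖ < (⌊‖x‖⌋₊ : ℝ) + 1 := fun x => Nat.lt_floor_add_one _
  have hle : ∀ x : E, ((⌊‖x‖⌋₊ : ℕ) : ℝ) ≤ ‖x‖ := fun x => Nat.floor_le (norm_nonneg x)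
  let c : ℕ → ℝ := fun k => (((k : ℝ) + 1) ^ (N + 2))⁻¹
  have hc : ∀ k, 0 ≤ c k := fun k => by positivity
  have hpt : ∀ x : E, ‖(1 + ‖x‖) ^ (-((N + 2 : ℕ) : ℝ))‖ₑ ≤
      ∑' k : ℕ, (ball (0 : E) ((k : ℝ) + 1)).indicator (fun _ => ENNReal.ofReal (c k)) x := by
    intro x
    refine le_trans ?_ (ENNReal.le_tsum ⌊‖x‖⌋₊)
    rw [indicator_of_mem (by simpa using hlt x), ← ofReal_norm]
    apply ENNReal.ofReal_le_ofReal
    have h0 : (0 : ℝ) ≤ 1 + ‖x‖ := by positivity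
    rw [Real.rpow_neg h0, Real.rpow_natCast, Real.norm_of_nonneg (by positivity)]
    apply inv_anti₀ (by positivity)
    exact pow_le_pow_left₀ (by positivity) (by linarith [hle x]) _
  have hsum : Summable (fun k : ℕ => μ.var.real (ball (0 : E) ((k : ℝ) + 1)) * c k) := by
    have ht : Tendsto (fun k : ℕ => (k : ℝ) + 1) atTop atTop :=
      tendsto_atTop_add_const_right _ _ tendsto_natCast_atTop_atTop
    have h1 := hN.comp_tendsto ht
    have h2 := h1.mul (Asymptotics.isBigO_refl c atTop)
    have h3 : Summable (fun k : ℕ => (((k + 1 : ℕ) : ℝ) ^ 2)⁻¹) :=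
      (summable_nat_add_iff 1).2 (Real.summable_nat_pow_inv.2 one_lt_two)
    refine summable_of_isBigO_nat h3 (h2.trans (Asymptotics.isBigO_of_le _ fun k => ?_))
    have hk : ((k : ℝ) + 1) ≠ 0 := by positivity
    apply le_of_eq
    congr 1
    simp only [Function.comp, c]
    push_cast
    field_simp
    ring
  refine lt_of_le_of_lt (lintegral_mono hpt) ?_
  rw [lintegral_tsum fun k => (measurable_const.indicator measurableSet_ball).aemeasurable]
  have hterm : ∀ k : ℕ,
      ∫⁻ x, (ball (0 : E) ((k : ℝ) + 1)).indicator (fun _ => ENNReal.ofReal (c k)) x ∂μ.var =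
        ENNReal.ofReal (μ.var.real (ball (0 : E) ((k : ℝ) + 1)) * c k) := by
    intro k
    rw [lintegral_indicator_const measurableSet_ball, ENNReal.ofReal_mul measureReal_nonneg,
      ofReal_measureReal (measure_ball_lt_top.ne), mul_comm]
  simp_rw [hterm]
  exact hsum.tsum_ofReal_lt_top

/-- The tempered distribution `φ ↦ ∫ φ dμ` defined by a slowly increasing measure. -/
def toTemperedDistribution (μ : SlowlyIncreasingMeasure E) : 𝓢'(E, ℂ) :=
  haveI := μ.hasTemperateGrowth
  Lp.toTemperedDistribution (μ.memLp_phase.toLp μ.phase)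

theorem toTemperedDistribution_apply (μ : SlowlyIncreasingMeasure E) (φ : 𝓢(E, ℂ)) :
    μ.toTemperedDistribution φ = ∫ x, φ x * μ.phase x ∂μ.var := by
  have := μ.hasTemperateGrowth
  rw [toTemperedDistribution, Lp.toTemperedDistribution_apply]
  apply integral_congr_ae
  filter_upwards [μ.memLp_phase.coeFn_toLp] with x hx
  rw [hx, smul_eq_mul]

/-- The Fourier transform of `μ`, in the sense of tempered distributions and with the kernel
`exp (-2 π i ⟨t, x⟩)`, is the measure `ν`. -/
def HasFourierTransform (μ ν : SlowlyIncreasingMeasure E) : Prop :=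
  𝓕 μ.toTemperedDistribution = ν.toTemperedDistribution

end SlowlyIncreasingMeasure

end Quasicrystal

end

/-! If the spectrum `S` is not uniformly discrete, it contains pairs at arbitrarily small distance.
The core (`exists_radius`) shows that a difference `s - s'` of two points of `S` recurs: some pair
of points of `S` with this same difference lies in every ball of radius comparable to `1 / d(Λ -
Λ)`. A ball with finitely many points of `S` has a least distance between them, so choosing `s, s'`
closer than that gives a contradiction. Accumulation points follow by compactness.

For the recurrence, rescale so that `Λ - Λ` is `1`-separated and take two modulations of `μ`, with
Fourier coefficients `a₁`, `a₂`, so that `a₁ * conj a₂` is non-zero exactly where the wanted pairs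
sit. Smoothing by `φ` turns the modulated measures into absolutely convergent trigonometric series,
and the mean of one, translated by `x`, times the conjugate of the other is `G x = ∑ a₁ conj(a₂)
|φ̂|² e(⟨s, x⟩)`. In physical space `G` lives near `Λ - Λ`, and near each `k ∈ Λ - Λ` it is a
bounded coefficient `β k` times one fixed profile (`FourierPair.exists_corr_eq`).

Suppose `a₁ * conj a₂` vanishes on a large ball. Averaging `G` against a concentrated kernel with
spectrum in that ball gives `0`, yet around `k` the average is nearly a fixed non-zero multiple of
`β k`, up to a small multiple of `sup |β|`. Hence `sup |β|` is at most half of itself, so `β = 0`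
and the product vanishes everywhere. -/

noncomputable section

open scoped ComplexConjugate ContDiff

namespace Quasicrystal

universe u

/-! ### Characters and mean values of absolutely convergent trigonometric series -/

section

variable {E : Type u} [NormedAddCommGroup E] [InnerProductSpace ℝ E]

/-- The character `y ↦ exp (2 π i ⟨s, y⟩)`. -/
def char (s y : E) : ℂ := (Real.fourierChar (inner ℝ s y) : ℂ)

@[simp] theorem norm_char (s y : E) : ‖char s y‖ = 1 := Circle.norm_coe _

@[simp] theorem char_zero_left (y : E) : char 0 y = 1 := by simp [char]

@[simp] theorem char_zero_right (s : E) : char s 0 = 1 := by simp [char]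

theorem char_add_left (s t y : E) : char (s + t) y = char s y * char t y := by
  simp [char, inner_add_left, AddChar.map_add_eq_mul]

theorem char_add_right (s y z : E) : char s (y + z) = char s y * char s z := by
  simp [char, inner_add_right, AddChar.map_add_eq_mul]

theorem char_neg_left (s y : E) : char (-s) y = char s (-y) := by
  simp [char]

theorem conj_char (s y : E) : conj (char s y) = char (-s) y := by
  simp [char, AddChar.map_neg_eq_inv]

theorem char_mul_char_neg (s y : E) : char s y * char (-s) y = 1 := by
  rw [← char_add_left, add_neg_cancel, char_zero_left]

theorem char_smul_left (c : ℝ) (s y : E) : char (c • s) y = char s (c • y) := by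
  simp [char, inner_smul_left, inner_smul_right]

theorem char_eq_cexp (s y : E) : char s y = Complex.exp (2 * Real.pi * Complex.I * inner ℝ s y) := by
  rw [char, Real.fourierChar_apply]; push_cast; congr 1; ring

theorem continuous_char (s : E) : Continuous (char s) := by
  simp_rw [funext (char_eq_cexp s)]; fun_prop

theorem contDiff_char (s : E) : ContDiff ℝ ∞ (char s) := by
  simp_rw [funext (char_eq_cexp s)]
  have : ContDiff ℝ ∞ fun y : E => ((inner ℝ s y : ℝ) : ℂ) :=
    Complex.ofRealCLM.contDiff.comp (contDiff_const.inner ℝ contDiff_id)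
  exact Complex.contDiff_exp.comp (contDiff_const.mul this)

/-- `F` is an absolutely convergent trigonometric series with mean value `m`. -/
def HasMean (F : E → ℂ) (m : ℂ) : Prop :=
  ∃ (ι : Type u) (c : ι → ℂ) (freq : ι → E), (Summable fun i => ‖c i‖) ∧
    (∀ y, F y = ∑' i, c i * char (freq i) y) ∧ m = ∑' i, {i | freq i = 0}.indicator c i

/-- Polarized Parseval: the product expands over pairs `(s, t)` with frequency `s - t`, and only the
diagonal has frequency zero. -/
theorem hasMean_mul_conj {c d : E → ℂ} (hc : Summable fun s => ‖c s‖)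
    (hd : Summable fun s => ‖d s‖) (x : E) :
    HasMean (fun y => (∑' s, c s * char s (y + x)) * conj (∑' s, d s * char s y))
      (∑' s, c s * conj (d s) * char s x) := by
  have hc' : Summable fun s => ‖c s * char s x‖ := by simpa using hc
  have hd' : Summable fun s => ‖conj (d s)‖ := by simpa using hd
  have h0 : Summable fun p : E × E => ‖c p.1 * char p.1 x * conj (d p.2)‖ :=
    Summable.mul_norm (f := fun s => c s * char s x) (g := fun s => conj (d s)) hc' hd'
  refine ⟨E × E, fun p => c p.1 * char p.1 x * conj (d p.2), fun p => p.1 - p.2,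
    h0, fun y => ?_, ?_⟩
  · have h1 : Summable fun s => ‖c s * char s (y + x)‖ := by simpa using hc
    have h2 : Summable fun s => ‖conj (d s * char s y)‖ := by simpa using hd
    have h3 := tsum_mul_tsum_of_summable_norm h1 h2
    beta_reduce
    rw [Complex.conj_tsum, h3]
    refine tsum_congr fun p => ?_
    rw [map_mul, conj_char, char_add_right, sub_eq_add_neg, char_add_left]
    ring
  · have hinj : Function.Injective fun s : E => (s, s) := fun a b h => (Prod.ext_iff.1 h).1
    have h4 : Function.support ({p : E × E | p.1 - p.2 = 0}.indicator
        fun p => c p.1 * char p.1 x * conj (d p.2)) ⊆ range fun s : E => (s, s) := by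
      rintro ⟨a, b⟩ h
      have : (a, b) ∈ {p : E × E | p.1 - p.2 = 0} := by
        by_contra hne
        exact h (indicator_of_notMem hne _)
      have : a - b = 0 := this
      exact ⟨a, by rw [sub_eq_zero.1 this]⟩
    rw [← hinj.tsum_eq h4]
    refine tsum_congr fun s => ?_
    rw [indicator_of_mem (by simp)]
    ring

theorem hasMean_zero : HasMean (fun _ : E => 0) 0 :=
  ⟨E, 0, 0, by simp, by simp, by simp⟩

variable [FiniteDimensional ℝ E] [MeasurableSpace E] [BorelSpace E]

theorem fourier_eq_integral_char (f : E → ℂ) (s : E) : 𝓕 f s = ∫ v, char (-s) v * f v := by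
  rw [Real.fourier_eq]
  simp only [char, Circle.smul_def, smul_eq_mul, inner_neg_left, real_inner_comm]

theorem fourierInv_eq_integral_char (f : E → ℂ) (s : E) : 𝓕⁻ f s = ∫ v, char s v * f v := by
  rw [Real.fourierInv_eq]
  simp only [char, Circle.smul_def, smul_eq_mul, real_inner_comm]

/-- Termwise integration of an absolutely convergent trigonometric series against an integrable
function. -/
theorem integral_tsum_char_mul {ι : Type*} {c : ι → ℂ} (freq : ι → E) (hc : Summable fun i => ‖c i‖)
    {η : E → ℂ} (hη : Integrable η) :
    ∫ y, (∑' i, c i * char (freq i) y) * η y = ∑' i, c i * ∫ y, char (freq i) y * η y := by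
  -- The index type is arbitrary, whereas termwise integration needs countably many terms;
  -- summability leaves only countably many non-zero ones.
  have hcs : (Function.support c).Countable := by
    have := hc.countable_support
    simpa [Function.support] using this
  have : Countable (Function.support c) := hcs.to_subtype
  have hint : ∀ i, Integrable (fun y => char (freq i) y * η y) := fun i =>
    hη.bdd_mul (c := 1) (continuous_char _).aestronglyMeasurable (Eventually.of_forall fun y => by simp)
  have h1 : ∀ y, (∑' i, c i * char (freq i) y) * η y =
      ∑' i : Function.support c, c i * (char (freq i) y * η y) := by
    intro y
    rw [← tsum_mul_right]
    simp_rw [mul_assoc]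
    exact (tsum_subtype_eq_of_support_subset (f := fun i => c i * (char (freq i) y * η y))
      fun i hi => left_ne_zero_of_mul hi).symm
  have h2 : ∑' i, c i * ∫ y, char (freq i) y * η y =
      ∑' i : Function.support c, c i * ∫ y, char (freq i) y * η y :=
    (tsum_subtype_eq_of_support_subset (f := fun i => c i * ∫ y, char (freq i) y * η y)
      fun i hi => left_ne_zero_of_mul hi).symm
  simp_rw [h1, h2]
  have h3 := integral_tsum_of_summable_integral_norm (μ := volume)
    (F := fun (i : Function.support c) y => c i * (char (freq i) y * η y))
    (fun i => (hint i).const_mul _) ?_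
  · rw [← h3]; simp_rw [integral_const_mul]
  · have : ∀ i : Function.support c, ∫ y, ‖c i * (char (freq i) y * η y)‖ = ‖c i‖ * ∫ y, ‖η y‖ := by
      intro i
      simp_rw [norm_mul, norm_char, one_mul, integral_const_mul]
    simp_rw [this]
    exact (hc.subtype _).mul_right _

theorem integrable_gaussian {b : ℝ} (hb : 0 < b) :
    Integrable fun y : E => Complex.exp (-b * ‖y‖ ^ 2) := by
  simpa using GaussianFourier.integrable_cexp_neg_mul_sq_norm_add (V := E)
    (b := b) (by simpa using hb) 0 0

theorem integral_char_mul_gaussian {b : ℝ} (hb : 0 < b) (w : E) :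
    ∫ y : E, char w y * Complex.exp (-b * ‖y‖ ^ 2) =
      Complex.exp (-(Real.pi ^ 2 / b * ‖w‖ ^ 2 : ℝ)) * ∫ y : E, Complex.exp (-b * ‖y‖ ^ 2) := by
  have h1 := GaussianFourier.integral_cexp_neg_mul_sq_norm_add (V := E) (b := b)
    (by simpa using hb) (2 * Real.pi * Complex.I) w
  have h2 := GaussianFourier.integral_cexp_neg_mul_sq_norm (V := E) (b := b)
    (by simpa using hb)
  rw [h2, mul_comm]
  refine Eq.trans ?_ (h1.trans ?_)
  · congr 1; ext y
    rw [char_eq_cexp, ← Complex.exp_add]; congr 1; ring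
  · congr 2
    have : (b : ℂ) ≠ 0 := by exact_mod_cast hb.ne'
    push_cast
    field_simp
    rw [Complex.I_sq]; ring

/-- The normalized Gaussian average of a character of frequency `w` is `exp (-π² ‖w‖² / b)`, which
as `b → 0` tends to `1` if `w = 0` and to `0` otherwise. So the mean depends on `F` alone and not on
the chosen series. -/
theorem HasMean.tendsto {F : E → ℂ} {m : ℂ} (h : HasMean F m) :
    Tendsto (fun b : ℝ => (∫ y : E, F y * Complex.exp (-b * ‖y‖ ^ 2)) /
      ∫ y : E, Complex.exp (-b * ‖y‖ ^ 2)) (𝓝[>] 0) (𝓝 m) := by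
  obtain ⟨ι, c, freq, hc, hF, rfl⟩ := h
  have key : ∀ᶠ b : ℝ in 𝓝[>] 0,
      ∑' i, c i * Complex.exp (-(Real.pi ^ 2 / b * ‖freq i‖ ^ 2 : ℝ)) =
      (∫ y : E, F y * Complex.exp (-b * ‖y‖ ^ 2)) / ∫ y : E, Complex.exp (-b * ‖y‖ ^ 2) := by
    filter_upwards [self_mem_nhdsWithin] with b hb
    have hb : 0 < b := hb
    have h0 : ∫ y : E, Complex.exp (-b * ‖y‖ ^ 2) ≠ 0 := by
      rw [GaussianFourier.integral_cexp_neg_mul_sq_norm (V := E) (b := b) (by simpa using hb)]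
      have : (Real.pi / b : ℂ) ≠ 0 := by
        exact_mod_cast (div_pos Real.pi_pos hb).ne'
      rw [Complex.cpow_def_of_ne_zero this]
      exact Complex.exp_ne_zero _
    rw [eq_div_iff h0]
    simp_rw [hF]
    rw [integral_tsum_char_mul freq hc (integrable_gaussian hb)]
    simp_rw [integral_char_mul_gaussian hb]
    rw [← tsum_mul_right]
    simp_rw [mul_assoc]
  refine Tendsto.congr' key ?_
  refine tendsto_tsum_of_dominated_convergence hc ?_ ?_
  · intro i
    by_cases hi : freq i = 0
    · simp [hi]
    · have h1 : {i | freq i = 0}.indicator c i = c i * 0 := by simp [hi]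
      rw [h1]
      refine Tendsto.mul tendsto_const_nhds ?_
      rw [tendsto_zero_iff_norm_tendsto_zero]
      have h2 : ∀ b : ℝ, ‖Complex.exp (-(Real.pi ^ 2 / b * ‖freq i‖ ^ 2 : ℝ))‖ =
          Real.exp (-(Real.pi ^ 2 * ‖freq i‖ ^ 2 * b⁻¹)) := by
        intro b
        rw [← Complex.ofReal_neg, Complex.norm_exp_ofReal]
        congr 1; ring
      simp_rw [h2]
      refine Real.tendsto_exp_neg_atTop_nhds_zero.comp ?_
      have : 0 < ‖freq i‖ := norm_pos_iff.2 hi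
      exact tendsto_inv_nhdsGT_zero.const_mul_atTop (by positivity)
  · filter_upwards [self_mem_nhdsWithin] with b hb i
    have hb : 0 < b := hb
    rw [norm_mul, ← Complex.ofReal_neg, Complex.norm_exp_ofReal]
    refine mul_le_of_le_one_right (norm_nonneg _) (Real.exp_le_one_iff.2 ?_)
    have : 0 ≤ Real.pi ^ 2 / b * ‖freq i‖ ^ 2 := by positivity
    linarith

theorem HasMean.unique {F : E → ℂ} {m m' : ℂ} (h : HasMean F m) (h' : HasMean F m') : m = m' :=
  tendsto_nhds_unique h.tendsto h'.tendsto

/-- Convolution with `η` multiplies the coefficient at frequency `w` by the Fourier transform of `η`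
at `w`, which for `w = 0` is `∫ η`. -/
theorem HasMean.integral_sub {F : E → ℂ} {m : ℂ} (h : HasMean F m) {η : E → ℂ}
    (hη : Integrable η) : HasMean (fun y => ∫ v, F (y - v) * η v) (m * ∫ v, η v) := by
  obtain ⟨ι, c, freq, hc, hF, rfl⟩ := h
  refine ⟨ι, fun i => c i * ∫ v, char (-freq i) v * η v, freq, ?_, fun y => ?_, ?_⟩
  · refine Summable.of_nonneg_of_le (fun _ => norm_nonneg _) (fun i => ?_)
      (hc.mul_right (∫ v, ‖η v‖))
    rw [norm_mul]
    gcongr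
    refine (norm_integral_le_integral_norm _).trans (le_of_eq ?_)
    simp
  · have h1 : ∀ v, F (y - v) = ∑' i, (c i * char (freq i) y) * char (-freq i) v := by
      intro v
      rw [hF]
      congr 1; ext i
      rw [sub_eq_add_neg, char_add_right, char_neg_left, mul_assoc]
    simp_rw [h1]
    rw [integral_tsum_char_mul (fun i => -freq i) (by simpa using hc) hη]
    congr 1; ext i; ring
  · rw [← tsum_mul_right]
    congr 1; ext i
    by_cases hi : freq i = 0 <;> simp [hi]

/-- An absolutely convergent trigonometric series which vanishes identically has vanishing
coefficients. -/
theorem eq_zero_of_tsum_char_eq_zero {c : E → ℂ} (hc : Summable fun s => ‖c s‖)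
    (h : ∀ y, ∑' s, c s * char s y = 0) (s₀ : E) : c s₀ = 0 := by
  -- Multiplication by `char (-s₀)` moves the frequency `s₀` to zero, so `c s₀` becomes a mean
  -- value.
  have h1 : HasMean (fun _ : E => 0) (c s₀) := by
    refine ⟨E, c, fun s => s - s₀, hc, fun y => ?_, ?_⟩
    · have : ∀ s, c s * char (s - s₀) y = c s * char s y * char (-s₀) y := fun s => by
        rw [sub_eq_add_neg, char_add_left]; ring
      simp_rw [this, tsum_mul_right, h, zero_mul]
    · rw [tsum_eq_single s₀]
      · simp
      · intro s hs; simp [sub_eq_zero, hs]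
  exact h1.unique hasMean_zero

end

/-! ### Smoothed discrete measures and their correlations -/

section

variable {E : Type u} [NormedAddCommGroup E]

/-- The convolution of the discrete measure `∑ m l • δ_l` with `φ`. -/
def comb (m φ : E → ℂ) (y : E) : ℂ := ∑' l, m l * φ (y - l)

theorem comb_eq_single {m φ : E → ℂ} {y : E} (l₀ : E)
    (h : ∀ l, l ≠ l₀ → m l ≠ 0 → φ (y - l) = 0) : comb m φ y = m l₀ * φ (y - l₀) :=
  tsum_eq_single l₀ fun l hl => by
    by_cases hm : m l = 0
    · rw [hm, zero_mul]
    · rw [h l hl hm, mul_zero]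

theorem comb_eq_zero {m φ : E → ℂ} {y : E} (h : ∀ l, m l ≠ 0 → φ (y - l) = 0) :
    comb m φ y = 0 := by
  have h0 : ∀ l, m l * φ (y - l) = 0 := fun l => by
    by_cases hm : m l = 0
    · rw [hm, zero_mul]
    · rw [h l hm, mul_zero]
  simp [comb, h0]

theorem eq_zero_of_support_subset_ball {φ : E → ℂ} {r : ℝ} (h : Function.support φ ⊆ ball 0 r)
    {z : E} (hz : r ≤ ‖z‖) : φ z = 0 := by
  by_contra hne
  exact absurd (mem_ball_zero_iff.1 (h hne)) (not_lt.2 hz)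

/-- The set `Λ - Λ` is `1`-separated. -/
def DiffSeparated (Λ : Set E) : Prop := ∀ p ∈ Λ - Λ, ∀ q ∈ Λ - Λ, p ≠ q → 1 ≤ ‖p - q‖

theorem DiffSeparated.one_le_norm_sub {Λ : Set E} (h : DiffSeparated Λ) {l l' : E} (hl : l ∈ Λ)
    (hl' : l' ∈ Λ) (hne : l ≠ l') : 1 ≤ ‖l - l'‖ := by
  simpa using h (l - l') (sub_mem_sub hl hl') (l - l) (sub_mem_sub hl hl)
    (by simpa [sub_eq_zero] using hne)

section

variable {Λ : Set E} {m₁ m₂ φ ψ : E → ℂ}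

/-- If `y` is within `1/16` of some `l ∈ Λ`, only `l` contributes to the second factor. A point `l'`
contributing to the first then has `l' - l` within `1/16 + 1/8 + 1/4 < 1` of `k`, and separation of
`Λ - Λ` forces `l' = l + k`. -/
theorem comb_mul_conj_comb (hΛ : DiffSeparated Λ) (hm₁ : Function.support m₁ ⊆ Λ)
    (hm₂ : Function.support m₂ ⊆ Λ) (hφ : Function.support φ ⊆ ball 0 (1 / 4))
    (hψ : Function.support ψ ⊆ ball 0 (1 / 16)) {k v : E} (hk : k ∈ Λ - Λ) (hv : ‖v‖ ≤ 1 / 8)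
    (y : E) :
    comb m₁ φ (y + (k + v)) * conj (comb m₂ ψ y) =
      comb (fun l => m₁ (l + k) * conj (m₂ l)) (fun u => φ (u + v) * conj (ψ u)) y := by
  by_cases h : ∃ l ∈ Λ, ‖y - l‖ < 1 / 16
  · obtain ⟨l, hl, hyl⟩ := h
    have hfar : ∀ l', l' ≠ l → m₂ l' ≠ 0 → ψ (y - l') = 0 := by
      intro l' hne hm
      apply eq_zero_of_support_subset_ball hψ
      have h1 := hΛ.one_le_norm_sub (hm₂ hm) hl hne
      have h2 : ‖l' - l‖ ≤ ‖y - l‖ + ‖y - l'‖ := by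
        rw [show l' - l = (y - l) - (y - l') by abel]; exact norm_sub_le _ _
      linarith
    rw [comb_eq_single l hfar, comb_eq_single (l + k), comb_eq_single l]
    · rw [show y + (k + v) - (l + k) = y - l + v by abel, map_mul]; ring
    · intro l' hne hw
      simp only [hfar l' hne fun h0 => hw (by simp [h0]), map_zero, mul_zero]
    · intro l' hne hm
      apply eq_zero_of_support_subset_ball hφ
      have h1 := hΛ (l' - l) (sub_mem_sub (hm₁ hm) hl) k hk fun h => hne (by rw [← h]; abel)
      have h2 : ‖l' - l - k‖ ≤ ‖y - l‖ + ‖v‖ + ‖y + (k + v) - l'‖ := by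
        rw [show l' - l - k = (y - l) + v - (y + (k + v) - l') by abel]
        exact (norm_sub_le _ _).trans (by gcongr; exact norm_add_le _ _)
      linarith
  · push Not at h
    have h0 : ∀ l, m₂ l ≠ 0 → ψ (y - l) = 0 := fun l hl =>
      eq_zero_of_support_subset_ball hψ (h l (hm₂ hl))
    have h1 : comb (fun l => m₁ (l + k) * conj (m₂ l)) (fun u => φ (u + v) * conj (ψ u)) y = 0 := by
      refine comb_eq_zero fun l hl => ?_
      simp only [h0 l fun h0 => hl (by simp [h0]), map_zero, mul_zero]
    rw [comb_eq_zero h0, h1, map_zero, mul_zero]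

theorem comb_mul_conj_comb_eq_zero (hm₁ : Function.support m₁ ⊆ Λ)
    (hm₂ : Function.support m₂ ⊆ Λ) (hφ : Function.support φ ⊆ ball 0 (1 / 16))
    (hψ : Function.support ψ ⊆ ball 0 (1 / 16)) {x : E} (hx : ∀ k ∈ Λ - Λ, 1 / 8 < ‖x - k‖)
    (y : E) : comb m₁ φ (y + x) * conj (comb m₂ ψ y) = 0 := by
  by_contra hne
  have h1 : ∃ l, m₁ l ≠ 0 ∧ φ (y + x - l) ≠ 0 := by
    by_contra! h
    exact hne (by rw [comb_eq_zero h, zero_mul])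
  have h2 : ∃ l, m₂ l ≠ 0 ∧ ψ (y - l) ≠ 0 := by
    by_contra! h
    exact hne (by rw [comb_eq_zero h, map_zero, mul_zero])
  obtain ⟨l, hl, hl'⟩ := h1
  obtain ⟨j, hj, hj'⟩ := h2
  have h3 := hx (l - j) (sub_mem_sub (hm₁ hl) (hm₂ hj))
  have h4 := mem_ball_zero_iff.1 (hφ hl')
  have h5 := mem_ball_zero_iff.1 (hψ hj')
  have h6 : ‖x - (l - j)‖ ≤ ‖y + x - l‖ + ‖y - j‖ := by
    rw [show x - (l - j) = (y + x - l) - (y - j) by abel]; exact norm_sub_le _ _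
  linarith

end

section

variable {Λ : Set E} {w η η' : E → ℂ}

theorem comb_sub_mul (hΛ : DiffSeparated Λ) (hw : Function.support w ⊆ Λ)
    (hη : Function.support η ⊆ ball 0 (1 / 16)) (hη' : Function.support η' ⊆ ball 0 (1 / 16))
    {y l : E} (hl : l ∈ Λ) (hyl : ‖y - l‖ < 1 / 8) (v : E) :
    comb w η (y - v) * η' v = w l * (η (y - l - v) * η' v) := by
  by_cases hv : η' v = 0
  · simp [hv]
  rw [comb_eq_single l, show y - v - l = y - l - v by abel, mul_assoc]
  intro l' hne hm
  apply eq_zero_of_support_subset_ball hη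
  have h1 := hΛ.one_le_norm_sub (hw hm) hl hne
  have h2 : ‖l' - l‖ ≤ ‖y - l‖ + ‖v‖ + ‖y - v - l'‖ := by
    rw [show l' - l = (y - l) - v - (y - v - l') by abel]
    exact (norm_sub_le _ _).trans (by gcongr; exact norm_sub_le _ _)
  have h3 := mem_ball_zero_iff.1 (hη' hv)
  linarith

theorem comb_sub_mul_eq_zero (hw : Function.support w ⊆ Λ)
    (hη : Function.support η ⊆ ball 0 (1 / 16)) (hη' : Function.support η' ⊆ ball 0 (1 / 16))
    {y : E} (hy : ∀ l ∈ Λ, 1 / 8 ≤ ‖y - l‖) (v : E) : comb w η (y - v) * η' v = 0 := by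
  by_cases hv : η' v = 0
  · simp [hv]
  rw [comb_eq_zero, zero_mul]
  intro l hm
  apply eq_zero_of_support_subset_ball hη
  have h1 := hy l (hw hm)
  have h2 : ‖y - l‖ ≤ ‖v‖ + ‖y - v - l‖ := by
    rw [show y - l = v + (y - v - l) by abel]
    exact norm_add_le _ _
  have h3 := mem_ball_zero_iff.1 (hη' hv)
  linarith

end

variable [InnerProductSpace ℝ E]

theorem contDiff_conj {φ : E → ℂ} (h : ContDiff ℝ ∞ φ) : ContDiff ℝ ∞ fun x => conj (φ x) :=
  Complex.conjCLE.contDiff.comp h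

variable [FiniteDimensional ℝ E]

theorem hasCompactSupport_of_subset_ball {φ : E → ℂ} {r : ℝ}
    (h : Function.support φ ⊆ ball 0 r) : HasCompactSupport φ :=
  HasCompactSupport.of_support_subset_isCompact (isCompact_closedBall 0 r)
    (h.trans ball_subset_closedBall)

variable [MeasurableSpace E] [BorelSpace E]

/-- This is `(w * η) * η' = (w * η') * η` for convolutions. No summability of `w` is needed, since
at a given `y` at most one atom enters the integrand. -/
theorem integral_comb_sub_mul_comm {Λ : Set E} {w η η' : E → ℂ} (hΛ : DiffSeparated Λ)
    (hw : Function.support w ⊆ Λ)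
    (hη : Function.support η ⊆ ball 0 (1 / 16)) (hη' : Function.support η' ⊆ ball 0 (1 / 16))
    (y : E) : ∫ v, comb w η (y - v) * η' v = ∫ v, comb w η' (y - v) * η v := by
  by_cases h : ∃ l ∈ Λ, ‖y - l‖ < 1 / 8
  · obtain ⟨l, hl, hyl⟩ := h
    simp_rw [comb_sub_mul hΛ hw hη hη' hl hyl, comb_sub_mul hΛ hw hη' hη hl hyl,
      integral_const_mul]
    congr 1
    rw [← integral_sub_left_eq_self (fun v => η' (y - l - v) * η v) volume (y - l)]
    simp [mul_comm]
  · push Not at h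
    simp_rw [comb_sub_mul_eq_zero hw hη hη' h, comb_sub_mul_eq_zero hw hη' hη h]

/-- The measure `∑ a s • δ_s` is the Fourier transform of `∑ m l • δ_l`, tested against the
translates of smooth compactly supported functions. -/
def FourierPair (m a : E → ℂ) : Prop :=
  ∀ φ : E → ℂ, ContDiff ℝ ∞ φ → HasCompactSupport φ →
    (Summable fun s => ‖a s * 𝓕 φ s‖) ∧ ∀ y, comb m φ y = ∑' s, a s * 𝓕 φ s * char s y

/-- The correlation of the measures `∑ a₁ s * 𝓕 φ s • δ_s` and `∑ a₂ s * 𝓕 ψ s • δ_s`, as an almost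
periodic function. -/
def corr (a₁ a₂ φ ψ : E → ℂ) (x : E) : ℂ :=
  ∑' s, (a₁ s * 𝓕 φ s) * conj (a₂ s * 𝓕 ψ s) * char s x

section

variable {m₁ m₂ a₁ a₂ φ ψ : E → ℂ}

theorem FourierPair.hasMean_corr (h₁ : FourierPair m₁ a₁) (h₂ : FourierPair m₂ a₂)
    (hφ : ContDiff ℝ ∞ φ) (hφc : HasCompactSupport φ) (hψ : ContDiff ℝ ∞ ψ)
    (hψc : HasCompactSupport ψ) (x : E) :
    HasMean (fun y => comb m₁ φ (y + x) * conj (comb m₂ ψ y)) (corr a₁ a₂ φ ψ x) := by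
  obtain ⟨hs₁, he₁⟩ := h₁ φ hφ hφc
  obtain ⟨hs₂, he₂⟩ := h₂ ψ hψ hψc
  simp_rw [he₁, he₂]
  exact hasMean_mul_conj hs₁ hs₂ x

theorem FourierPair.summable_corr (h₁ : FourierPair m₁ a₁) (h₂ : FourierPair m₂ a₂)
    (hφ : ContDiff ℝ ∞ φ) (hφc : HasCompactSupport φ) (hψ : ContDiff ℝ ∞ ψ)
    (hψc : HasCompactSupport ψ) :
    Summable fun s => ‖(a₁ s * 𝓕 φ s) * conj (a₂ s * 𝓕 ψ s)‖ := by
  have hs₁ := (h₁ φ hφ hφc).1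
  have hs₂ : Summable fun s => ‖conj (a₂ s * 𝓕 ψ s)‖ := by simpa using (h₂ ψ hψ hψc).1
  have h := Summable.mul_norm (f := fun s => a₁ s * 𝓕 φ s)
    (g := fun s => conj (a₂ s * 𝓕 ψ s)) hs₁ hs₂
  have hinj : Function.Injective fun s : E => (s, s) := fun a b h => (Prod.ext_iff.1 h).1
  exact Summable.comp_injective
    (f := fun p : E × E => ‖(a₁ p.1 * 𝓕 φ p.1) * conj (a₂ p.2 * 𝓕 ψ p.2)‖)
    (i := fun s => (s, s)) h hinj

theorem norm_corr_le (h : Summable fun s => ‖(a₁ s * 𝓕 φ s) * conj (a₂ s * 𝓕 ψ s)‖) (x : E) :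
    ‖corr a₁ a₂ φ ψ x‖ ≤ ∑' s, ‖(a₁ s * 𝓕 φ s) * conj (a₂ s * 𝓕 ψ s)‖ := by
  have h' : Summable fun s => ‖(a₁ s * 𝓕 φ s) * conj (a₂ s * 𝓕 ψ s) * char s x‖ := by
    simpa using h
  refine (norm_tsum_le_tsum_norm h').trans (le_of_eq ?_)
  simp

theorem continuous_corr (h : Summable fun s => ‖(a₁ s * 𝓕 φ s) * conj (a₂ s * 𝓕 ψ s)‖) :
    Continuous (corr a₁ a₂ φ ψ) :=
  continuous_tsum (fun s => continuous_const.mul (continuous_char s)) h fun s x => by simp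

end

theorem exists_bump {r R : ℝ} (hr : 0 < r) (hR : r < R) :
    ∃ ρ : E → ℝ, ContDiff ℝ ∞ (fun x => (ρ x : ℂ)) ∧
      Function.support (fun x => (ρ x : ℂ)) ⊆ ball 0 R ∧ (∀ x, 0 ≤ ρ x) ∧ (∀ x, ρ x ≤ 1) ∧
      (∀ x, ‖x‖ ≤ r → ρ x = 1) ∧ 0 < ∫ x, ρ x := by
  let f : ContDiffBump (0 : E) := ⟨r, R, hr, hR⟩
  refine ⟨f, Complex.ofRealCLM.contDiff.comp f.contDiff, ?_, fun x => f.nonneg, fun x => f.le_one,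
    fun x hx => f.one_of_mem_closedBall (by simpa using hx), f.integral_pos⟩
  intro x hx
  have : x ∈ Function.support f := by simpa using hx
  rwa [f.support_eq] at this

/-- The pair correlations of `m₁` and `m₂` at the points of `Λ - Λ` have mean values, which are
uniformly bounded. -/
theorem FourierPair.exists_mean {Λ : Set E} {m₁ m₂ a₁ a₂ : E → ℂ} (h₁ : FourierPair m₁ a₁)
    (h₂ : FourierPair m₂ a₂) (hΛ : DiffSeparated Λ) (hm₁ : Function.support m₁ ⊆ Λ)
    (hm₂ : Function.support m₂ ⊆ Λ) :
    ∃ (β : E → ℂ) (B : ℝ), (∀ k, ‖β k‖ ≤ B) ∧ ∀ k ∈ Λ - Λ, ∀ η : E → ℂ, ContDiff ℝ ∞ η →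
      Function.support η ⊆ ball 0 (1 / 16) →
      HasMean (comb (fun l => m₁ (l + k) * conj (m₂ l)) η) (β k * ∫ u, η u) := by
  obtain ⟨Φ, hΦ, hΦs, -, -, hΦ1, -⟩ := exists_bump (E := E) (r := 1 / 16) (R := 1 / 8)
    (by norm_num) (by norm_num)
  obtain ⟨ρ, hρ, hρs, -, -, -, hρi⟩ := exists_bump (E := E) (r := 1 / 32) (R := 1 / 16)
    (by norm_num) (by norm_num)
  set Φ' : E → ℂ := fun x => Φ x with hΦ'
  set ρ' : E → ℂ := fun x => ρ x with hρ'
  set I : ℂ := ∫ u, ρ' u with hI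
  have hI0 : I ≠ 0 := by
    rw [hI, hρ', integral_complex_ofReal]; exact_mod_cast hρi.ne'
  have hconj : ∀ η : E → ℂ, Function.support η ⊆ ball 0 (1 / 16) →
      Function.support (fun x => conj (η x)) ⊆ ball 0 (1 / 16) := by
    intro η hη x hx
    exact hη fun h0 => hx (by simp [h0])
  have hΦc := hasCompactSupport_of_subset_ball hΦs
  have key : ∀ k ∈ Λ - Λ, ∀ η : E → ℂ, ContDiff ℝ ∞ η →
      Function.support η ⊆ ball 0 (1 / 16) →
      HasMean (comb (fun l => m₁ (l + k) * conj (m₂ l)) η)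
        (corr a₁ a₂ Φ' (fun x => conj (η x)) k) := by
    intro k hk η hη hηs
    have h := h₁.hasMean_corr h₂ hΦ hΦc (contDiff_conj hη)
      (hasCompactSupport_of_subset_ball (hconj η hηs)) k
    convert h using 1
    ext y
    -- `Φ` equals `1` on the support of `η`, so the product test function given by this identity is
    -- `η` itself.
    have h3 := comb_mul_conj_comb hΛ hm₁ hm₂
      (hΦs.trans (ball_subset_ball (by norm_num))) (hconj η hηs) hk (v := 0) (by simp) y
    rw [add_zero] at h3
    rw [h3]
    congr 1
    ext u
    by_cases hu : η u = 0
    · simp [hu]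
    · have := mem_ball_zero_iff.1 (hηs hu)
      simp [hΦ', hΦ1 u this.le]
  have hsum := h₁.summable_corr h₂ hΦ hΦc (contDiff_conj hρ)
    (hasCompactSupport_of_subset_ball (hconj ρ' hρs))
  -- The fixed bump `ρ` normalizes `β`. The bound is uniform because the sum of the moduli of the
  -- coefficients of `corr` does not involve `k`.
  refine ⟨fun k => corr a₁ a₂ Φ' (fun x => conj (ρ' x)) k / I,
    (∑' s, ‖(a₁ s * 𝓕 Φ' s) * conj (a₂ s * 𝓕 (fun x => conj (ρ' x)) s)‖) / ‖I‖, fun k => ?_,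
    fun k hk η hη hηs => ?_⟩
  · rw [norm_div]
    exact div_le_div_of_nonneg_right (norm_corr_le hsum k) (norm_nonneg I)
  · have h3 := key k hk η hη hηs
    have h4 := key k hk ρ' hρ hρs
    have hw : Function.support (fun l => m₁ (l + k) * conj (m₂ l)) ⊆ Λ := fun l hl =>
      hm₂ fun h0 => hl (by simp [h0])
    have hρint : Integrable ρ' :=
      hρ.continuous.integrable_of_hasCompactSupport (hasCompactSupport_of_subset_ball hρs)
    have hηint : Integrable η :=
      hη.continuous.integrable_of_hasCompactSupport (hasCompactSupport_of_subset_ball hηs)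
    -- The two iterated convolutions coincide, so `mean(w * η) ∫ ρ = mean(w * ρ) ∫ η`: the mean
    -- depends on `η` only through its integral.
    have h5 := h3.integral_sub hρint
    have h6 := h4.integral_sub hηint
    simp_rw [integral_comb_sub_mul_comm hΛ hw hηs hρs] at h5
    have h7 := h5.unique h6
    convert h3 using 1
    field_simp
    rw [mul_comm I]
    exact h7.symm

end

/-! ### Vanishing on a large ball forces vanishing everywhere -/

section

theorem forall_eq_zero_of_forall_half {X : Type*} {s : Set X} {β : X → ℂ} {B : ℝ}
    (hB : ∀ k ∈ s, ‖β k‖ ≤ B)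
    (h : ∀ B : ℝ, (∀ k ∈ s, ‖β k‖ ≤ B) → ∀ k ∈ s, ‖β k‖ ≤ 1 / 2 * B) : ∀ k ∈ s, β k = 0 := by
  have h1 : ∀ j : ℕ, ∀ k ∈ s, ‖β k‖ ≤ (1 / 2) ^ j * B := by
    intro j
    induction j with
    | zero => simpa using hB
    | succ j ih =>
      have := h _ ih
      simpa [pow_succ', mul_assoc] using this
  intro k hk
  have h2 : Tendsto (fun j : ℕ => (1 / 2 : ℝ) ^ j * B) atTop (𝓝 (0 * B)) :=
    (tendsto_pow_atTop_nhds_zero_of_lt_one (by norm_num) (by norm_num)).mul_const B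
  rw [zero_mul] at h2
  have h3 := ge_of_tendsto' h2 fun j => h1 j k hk
  exact norm_le_zero_iff.1 h3

variable {E : Type u} [NormedAddCommGroup E] [InnerProductSpace ℝ E] [FiniteDimensional ℝ E]
  [MeasurableSpace E] [BorelSpace E]

/-- The cross-correlation of two functions. -/
def crossCorr (φ ψ : E → ℂ) (v : E) : ℂ := ∫ u, φ (u + v) * conj (ψ u)

theorem crossCorr_eq_zero {φ ψ : E → ℂ} (hφ : Function.support φ ⊆ ball 0 (1 / 16))
    (hψ : Function.support ψ ⊆ ball 0 (1 / 16)) {v : E} (hv : 1 / 8 < ‖v‖) :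
    crossCorr φ ψ v = 0 := by
  have : ∀ u, φ (u + v) * conj (ψ u) = 0 := by
    intro u
    by_contra hne
    have h1 := mem_ball_zero_iff.1 (hφ (left_ne_zero_of_mul hne))
    have h2 := mem_ball_zero_iff.1 (hψ (show ψ u ≠ 0 from fun h0 => hne (by simp [h0])))
    have h3 : ‖v‖ ≤ ‖u + v‖ + ‖u‖ := by
      simpa using norm_sub_le (u + v) u
    linarith
  simp [crossCorr, this]

theorem norm_crossCorr_le {φ ψ : E → ℂ} (hφ : ∀ x, ‖φ x‖ ≤ 1) (hψ : Integrable ψ) (v : E) :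
    ‖crossCorr φ ψ v‖ ≤ ∫ u, ‖ψ u‖ := by
  refine norm_integral_le_of_norm_le hψ.norm (Eventually.of_forall fun u => ?_)
  rw [norm_mul, RCLike.norm_conj]
  exact mul_le_of_le_one_left (norm_nonneg _) (hφ _)

theorem continuous_crossCorr {φ ψ : E → ℂ} (hφ : ∀ x, ‖φ x‖ ≤ 1) (hφc : Continuous φ)
    (hψc : Continuous ψ) (hψ : Integrable ψ) : Continuous (crossCorr φ ψ) := by
  refine continuous_of_dominated (bound := fun u => ‖ψ u‖) (fun v => ?_) (fun v => ?_) hψ.norm ?_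
  · exact Continuous.aestronglyMeasurable (by fun_prop)
  · refine Eventually.of_forall fun u => ?_
    rw [norm_mul, RCLike.norm_conj]
    exact mul_le_of_le_one_left (norm_nonneg _) (hφ _)
  · exact Eventually.of_forall fun u => by fun_prop

/-- Near the points of `Λ - Λ`, the correlation function is a multiple of the
cross-correlation of the two test functions. -/
theorem FourierPair.exists_corr_eq {Λ : Set E} {m₁ m₂ a₁ a₂ : E → ℂ} (h₁ : FourierPair m₁ a₁)
    (h₂ : FourierPair m₂ a₂) (hΛ : DiffSeparated Λ) (hm₁ : Function.support m₁ ⊆ Λ)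
    (hm₂ : Function.support m₂ ⊆ Λ) :
    ∃ (β : E → ℂ) (B : ℝ), (∀ k, ‖β k‖ ≤ B) ∧ ∀ φ ψ : E → ℂ, ContDiff ℝ ∞ φ → ContDiff ℝ ∞ ψ →
      Function.support φ ⊆ ball 0 (1 / 16) → Function.support ψ ⊆ ball 0 (1 / 16) →
      (∀ k ∈ Λ - Λ, ∀ v : E, ‖v‖ ≤ 1 / 8 →
        corr a₁ a₂ φ ψ (k + v) = β k * crossCorr φ ψ v) ∧
      (∀ x, (∀ k ∈ Λ - Λ, 1 / 8 < ‖x - k‖) → corr a₁ a₂ φ ψ x = 0) := by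
  obtain ⟨β, B, hB, hβ⟩ := h₁.exists_mean h₂ hΛ hm₁ hm₂
  refine ⟨β, B, hB, fun φ ψ hφ hψ hφs hψs => ?_⟩
  have hmean := h₁.hasMean_corr h₂ hφ (hasCompactSupport_of_subset_ball hφs) hψ
    (hasCompactSupport_of_subset_ball hψs)
  refine ⟨fun k hk v hv => ?_, fun x hx => ?_⟩
  · have h3 := hmean (k + v)
    simp_rw [comb_mul_conj_comb hΛ hm₁ hm₂ (hφs.trans (ball_subset_ball (by norm_num))) hψs hk hv]
      at h3
    -- The test function `u ↦ φ (u + v) * conj (ψ u)` has integral `crossCorr φ ψ v`, and its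
    -- support lies in that of `ψ`.
    refine h3.unique (hβ k hk _ ?_ ?_)
    · exact (hφ.comp (contDiff_id.add contDiff_const)).mul (contDiff_conj hψ)
    · intro u hu
      exact hψs fun h0 => hu (by simp [h0])
  · have h3 := hmean x
    simp_rw [comb_mul_conj_comb_eq_zero hm₁ hm₂ hφs hψs hx] at h3
    exact h3.unique hasMean_zero

/-- A band-limited averaging kernel, the inverse Fourier transform of a bump equal to `1` at the
origin. -/
theorem exists_integrable_fourier_eq_zero :
    ∃ χ : E → ℂ, Integrable χ ∧ (∀ s, 1 ≤ ‖s‖ → 𝓕 χ s = 0) ∧ ∫ v, χ v = 1 := by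
  obtain ⟨ρ, hρ, hρs, -, -, hρ1, -⟩ := exists_bump (E := E) (r := 1 / 2) (R := 1)
    (by norm_num) (by norm_num)
  let f : 𝓢(E, ℂ) := (hasCompactSupport_of_subset_ball hρs).toSchwartzMap hρ
  have hf : ∀ x, f x = ρ x := fun x => rfl
  have hF : ∀ s, 𝓕 ((𝓕⁻ f : 𝓢(E, ℂ)) : E → ℂ) s = ρ s := by
    intro s
    rw [← hf, ← SchwartzMap.fourier_coe, FourierTransform.fourier_fourierInv_eq]
  refine ⟨(𝓕⁻ f : 𝓢(E, ℂ)), SchwartzMap.integrable _, fun s hs => ?_, ?_⟩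
  · rw [hF]; exact eq_zero_of_support_subset_ball hρs hs
  · have := hF 0
    rw [fourier_eq_integral_char] at this
    simpa [hρ1 0 (by simp)] using this

/-- As `K → ∞` the rescaled kernel concentrates at the origin: the tail tends to `0` while the right
side tends to `‖θ 0‖ / 2`. The scale depends only on `θ`, `χ` and `T`, which is what makes the final
constant depend on the space alone. -/
theorem exists_scale {θ χ : E → ℂ} {T : ℝ} (hθ : Continuous θ) (hT : ∀ v, ‖θ v‖ ≤ T)
    (hθ0 : θ 0 ≠ 0) (hχ : Integrable χ) (hχ1 : ∫ v, χ v = 1) :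
    ∃ K : ℝ, 0 < K ∧ T * ∫ v, {v : E | 1 / 8 < ‖K⁻¹ • v‖}.indicator (fun v => ‖χ v‖) v <
      1 / 2 * ‖∫ v, θ (-(K⁻¹ • v)) * χ v‖ := by
  have h0 : Tendsto (fun K : ℝ => T * ∫ v, {v : E | 1 / 8 < ‖K⁻¹ • v‖}.indicator
      (fun v => ‖χ v‖) v) atTop (𝓝 (T * ∫ v : E, 0)) := by
    refine tendsto_const_nhds.mul ?_
    refine tendsto_integral_filter_of_dominated_convergence (fun v => ‖χ v‖) ?_ ?_ hχ.norm ?_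
    · refine Eventually.of_forall fun K => hχ.norm.aestronglyMeasurable.indicator ?_
      exact measurableSet_lt measurable_const (by fun_prop)
    · refine Eventually.of_forall fun K => Eventually.of_forall fun v => ?_
      rw [norm_indicator_eq_indicator_norm]
      exact (indicator_le_self' (fun _ _ => norm_nonneg _) _).trans (by simp)
    · refine Eventually.of_forall fun v => ?_
      have h1 : Tendsto (fun K : ℝ => ‖K⁻¹ • v‖) atTop (𝓝 ‖(0 : ℝ) • v‖) :=
        (tendsto_inv_atTop_zero.smul_const v).norm
      rw [zero_smul, norm_zero] at h1
      refine tendsto_const_nhds.congr' ?_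
      filter_upwards [h1.eventually_lt_const (show (0 : ℝ) < 1 / 8 by norm_num)] with K hK
      rw [indicator_of_notMem]
      simpa using hK.le
  have h1 : Tendsto (fun K : ℝ => ∫ v, θ (-(K⁻¹ • v)) * χ v) atTop (𝓝 (∫ v, θ 0 * χ v)) := by
    refine tendsto_integral_filter_of_dominated_convergence (fun v => T * ‖χ v‖) ?_ ?_
      (hχ.norm.const_mul T) ?_
    · refine Eventually.of_forall fun K => AEStronglyMeasurable.mul ?_ hχ.aestronglyMeasurable
      exact Continuous.aestronglyMeasurable (by fun_prop)
    · refine Eventually.of_forall fun K => Eventually.of_forall fun v => ?_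
      rw [norm_mul]
      gcongr
      exact hT _
    · refine Eventually.of_forall fun v => Tendsto.mul_const _ ?_
      have h2 : Tendsto (fun K : ℝ => -(K⁻¹ • v)) atTop (𝓝 (-((0 : ℝ) • v))) :=
        (tendsto_inv_atTop_zero.smul_const v).neg
      rw [zero_smul, neg_zero] at h2
      exact (hθ.tendsto 0).comp h2
  rw [integral_const_mul, hχ1, mul_one] at h1
  have h2 := h1.norm.const_mul (1 / 2)
  have h3 := h0.eventually_lt h2 (by simpa using hθ0)
  obtain ⟨K, hK, hK'⟩ := (h3.and (eventually_gt_atTop 0)).exists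
  exact ⟨K, hK', hK⟩

theorem integral_corr_mul {a₁ a₂ φ ψ χ : E → ℂ}
    (hsum : Summable fun s => ‖(a₁ s * 𝓕 φ s) * conj (a₂ s * 𝓕 ψ s)‖) (hχ : Integrable χ)
    (h : E) (c : ℝ) :
    ∫ v, corr a₁ a₂ φ ψ (h - c • v) * χ v =
      ∑' s, (a₁ s * 𝓕 φ s) * conj (a₂ s * 𝓕 ψ s) * char s h * 𝓕 χ (c • s) := by
  have h1 : ∀ v, corr a₁ a₂ φ ψ (h - c • v) =
      ∑' s, ((a₁ s * 𝓕 φ s) * conj (a₂ s * 𝓕 ψ s) * char s h) * char (-(c • s)) v := by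
    intro v
    refine tsum_congr fun s => ?_
    rw [sub_eq_add_neg, char_add_right, ← smul_neg, ← char_smul_left, char_neg_left]
    ring
  simp_rw [h1]
  rw [integral_tsum_char_mul (fun s => -(c • s)) (by simpa using hsum) hχ]
  simp_rw [fourier_eq_integral_char]

/-- If `Λ - Λ` is `1`-separated, the product of the Fourier coefficients of two measures supported
by `Λ` cannot vanish in a large ball unless it vanishes everywhere. -/
theorem exists_radius (E : Type u) [NormedAddCommGroup E] [InnerProductSpace ℝ E]
    [FiniteDimensional ℝ E] [MeasurableSpace E] [BorelSpace E] :
    ∃ C : ℝ, 0 < C ∧ ∀ (Λ : Set E) (m₁ m₂ a₁ a₂ : E → ℂ), DiffSeparated Λ →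
      Function.support m₁ ⊆ Λ → Function.support m₂ ⊆ Λ → FourierPair m₁ a₁ → FourierPair m₂ a₂ →
      (∀ s, ‖s‖ < C → a₁ s * conj (a₂ s) = 0) → ∀ s, a₁ s * conj (a₂ s) = 0 := by
  obtain ⟨χ, hχ, hχF, hχ1⟩ := exists_integrable_fourier_eq_zero (E := E)
  obtain ⟨ρ, hρ, hρs, hρ0, hρ1, -, hρi⟩ := exists_bump (E := E) (r := 1 / 32) (R := 1 / 16)
    (by norm_num) (by norm_num)
  set φ : E → ℂ := fun x => ρ x with hφ
  have hφc := hasCompactSupport_of_subset_ball hρs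
  have hφ1 : ∀ x, ‖φ x‖ ≤ 1 := fun x => by
    simpa [hφ, abs_of_nonneg (hρ0 x)] using hρ1 x
  have hφint : Integrable φ := hρ.continuous.integrable_of_hasCompactSupport hφc
  set θ := crossCorr φ φ with hθ
  have hθc : Continuous θ := continuous_crossCorr hφ1 hρ.continuous hρ.continuous hφint
  have hθT' := norm_crossCorr_le hφ1 hφint
  set T := ∫ u, ‖φ u‖ with hT
  have hθT : ∀ v, ‖θ v‖ ≤ T := hθT'
  have hθ0 : θ 0 ≠ 0 := by
    have h0 : ∀ u, φ (u + 0) * conj (φ u) = ((ρ u * ρ u : ℝ) : ℂ) := fun u => by simp [hφ]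
    have h1 : Integrable fun u => ρ u * ρ u := by
      have : Integrable fun u => ((ρ u * ρ u : ℝ) : ℂ) := by
        have := (hρ.continuous.mul hρ.continuous).integrable_of_hasCompactSupport (μ := volume)
          (hφc.mul_right (f' := φ))
        simpa [hφ, Pi.mul_def] using this
      simpa using this.re
    rw [hθ, crossCorr]
    simp_rw [h0]
    rw [integral_complex_ofReal, Complex.ofReal_ne_zero]
    refine ((integral_pos_iff_support_of_nonneg (fun u => mul_self_nonneg _) h1).2 ?_).ne'
    have h2 := (integral_pos_iff_support_of_nonneg hρ0 (by simpa [hφ] using hφint.re)).1 hρi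
    simpa [Function.support] using h2
  obtain ⟨K, hK, hKlt⟩ := exists_scale hθc hθT hθ0 hχ hχ1
  set I := ∫ v, θ (-(K⁻¹ • v)) * χ v with hI
  set tail := ∫ v, {v : E | 1 / 8 < ‖K⁻¹ • v‖}.indicator (fun v => ‖χ v‖) v with htail
  have hT0 : 0 ≤ T := integral_nonneg fun _ => norm_nonneg _
  have htail0 : 0 ≤ tail :=
    integral_nonneg fun _ => indicator_nonneg (fun _ _ => norm_nonneg _) _
  have hI0 : 0 < ‖I‖ := by
    have : 0 ≤ T * tail := by positivity
    linarith
  refine ⟨K, hK, fun Λ m₁ m₂ a₁ a₂ hΛ hm₁ hm₂ h₁ h₂ hvan => ?_⟩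
  obtain ⟨β, B, hB, hβ⟩ := h₁.exists_corr_eq h₂ hΛ hm₁ hm₂
  have hsum := h₁.summable_corr h₂ hρ hφc hρ hφc
  set G := corr a₁ a₂ φ φ with hG
  obtain ⟨hnear, hfar⟩ : (∀ k ∈ Λ - Λ, ∀ v : E, ‖v‖ ≤ 1 / 8 → G (k + v) = β k * θ v) ∧
      (∀ x, (∀ k ∈ Λ - Λ, 1 / 8 < ‖x - k‖) → G x = 0) := hβ φ φ hρ hρ hρs hρs
  have hGc : Continuous G := continuous_corr hsum
  -- Frequencies below `K` are absent from `G` by hypothesis, and the rescaled kernel removes the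
  -- others.
  have hzero : ∀ k, ∫ v, G (k - K⁻¹ • v) * χ v = 0 := by
    intro k
    rw [integral_corr_mul hsum hχ]
    have : ∀ s, (a₁ s * 𝓕 φ s) * conj (a₂ s * 𝓕 φ s) * char s k * 𝓕 χ (K⁻¹ • s) = 0 := by
      intro s
      rcases lt_or_ge ‖s‖ K with hs | hs
      · rw [map_mul, show a₁ s * 𝓕 φ s * (conj (a₂ s) * conj (𝓕 φ s)) * char s k * 𝓕 χ (K⁻¹ • s) =
          a₁ s * conj (a₂ s) * (𝓕 φ s * conj (𝓕 φ s) * char s k * 𝓕 χ (K⁻¹ • s)) by ring,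
          hvan s hs, zero_mul]
      · rw [hχF, mul_zero]
        rw [norm_smul, norm_inv, Real.norm_of_nonneg hK.le, ← div_eq_inv_mul]
        exact (one_le_div hK).2 hs
    simp only [this, tsum_zero]
  -- Where `‖K⁻¹ • v‖ ≤ 1/8`, `G` equals `β k` times the profile `θ`; beyond, `θ` vanishes and `‖G‖
  -- ≤ B * T`. As the average of `G` is zero, `‖β k‖ * ‖I‖ ≤ B * T * tail`.
  have hhalf : ∀ B : ℝ, (∀ k ∈ Λ - Λ, ‖β k‖ ≤ B) → ∀ k ∈ Λ - Λ, ‖β k‖ ≤ 1 / 2 * B := by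
    intro B hB k hk
    have hB0 : 0 ≤ B := (norm_nonneg _).trans (hB k hk)
    have hGT : ∀ x, ‖G x‖ ≤ B * T := by
      intro x
      by_cases hx : ∀ k ∈ Λ - Λ, 1 / 8 < ‖x - k‖
      · rw [hfar x hx, norm_zero]; positivity
      · push Not at hx
        obtain ⟨j, hj, hxj⟩ := hx
        have := hnear j hj (x - j) hxj
        rw [add_sub_cancel] at this
        rw [this, norm_mul]
        exact mul_le_mul (hB j hj) (hθT _) (norm_nonneg _) hB0
    have hint1 : Integrable fun v => G (k - K⁻¹ • v) * χ v :=
      hχ.bdd_mul (c := B * T) (Continuous.aestronglyMeasurable (by fun_prop))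
        (Eventually.of_forall fun v => hGT _)
    have hint2 : Integrable fun v => β k * (θ (-(K⁻¹ • v)) * χ v) :=
      (hχ.bdd_mul (c := T) (Continuous.aestronglyMeasurable (by fun_prop))
        (Eventually.of_forall fun v => hθT _)).const_mul _
    have hintd : Integrable fun v => {v : E | 1 / 8 < ‖K⁻¹ • v‖}.indicator (fun v => ‖χ v‖) v :=
      hχ.norm.indicator (measurableSet_lt measurable_const (by fun_prop))
    have h3 : β k * I =
        -∫ v, (G (k - K⁻¹ • v) * χ v - β k * (θ (-(K⁻¹ • v)) * χ v)) := by
      rw [integral_sub hint1 hint2, hzero, integral_const_mul, zero_sub, neg_neg]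
    have h4 : ‖β k * I‖ ≤ B * T * tail := by
      rw [h3, norm_neg, htail, ← integral_const_mul]
      refine norm_integral_le_of_norm_le (hintd.const_mul _) (Eventually.of_forall fun v => ?_)
      by_cases hv : v ∈ {v : E | 1 / 8 < ‖K⁻¹ • v‖}
      · rw [indicator_of_mem hv, hθ, crossCorr_eq_zero hρs hρs (by simpa using hv)]
        rw [zero_mul, mul_zero, sub_zero, norm_mul]
        gcongr
        exact hGT _
      · rw [indicator_of_notMem hv, sub_eq_add_neg k, hnear k hk _ (by simpa using hv)]
        simp [mul_assoc]
    rw [norm_mul] at h4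
    have h5 : ‖β k‖ * ‖I‖ ≤ (1 / 2 * B) * ‖I‖ := by
      calc ‖β k‖ * ‖I‖ ≤ B * (T * tail) := by rw [← mul_assoc]; exact h4
        _ ≤ B * (1 / 2 * ‖I‖) := by gcongr
        _ = _ := by ring
    exact le_of_mul_le_mul_right h5 hI0
  have hβ0 := forall_eq_zero_of_forall_half (fun k _ => hB k) hhalf
  intro s₀
  -- Since `β` is common to all test functions, the correlation also vanishes for this modulated
  -- bump, whose Fourier transform at `s₀` is `∫ ρ ≠ 0`.
  set f : E → ℂ := fun x => char s₀ x * φ x with hf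
  have hfs : Function.support f ⊆ ball 0 (1 / 16) := fun x hx =>
    hρs (right_ne_zero_of_mul hx)
  have hfd : ContDiff ℝ ∞ f := (contDiff_char s₀).mul hρ
  have hfc := hasCompactSupport_of_subset_ball hfs
  obtain ⟨hn, hr⟩ := hβ f f hfd hfd hfs hfs
  have hcorr : ∀ x, corr a₁ a₂ f f x = 0 := by
    intro x
    by_cases hx : ∀ k ∈ Λ - Λ, 1 / 8 < ‖x - k‖
    · exact hr x hx
    · push Not at hx
      obtain ⟨j, hj, hxj⟩ := hx
      have := hn j hj (x - j) hxj
      rwa [add_sub_cancel, hβ0 j hj, zero_mul] at this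
  have h6 := eq_zero_of_tsum_char_eq_zero (h₁.summable_corr h₂ hfd hfc hfd hfc) hcorr s₀
  have h7 : 𝓕 f s₀ ≠ 0 := by
    rw [fourier_eq_integral_char]
    have : ∀ v, char (-s₀) v * f v = ρ v := fun v => by
      rw [hf, ← mul_assoc, mul_comm (char (-s₀) v), char_mul_char_neg, one_mul]
    simp_rw [this]
    rw [integral_complex_ofReal]
    exact_mod_cast hρi.ne'
  rw [map_mul, show a₁ s₀ * 𝓕 f s₀ * (conj (a₂ s₀) * conj (𝓕 f s₀)) =
    a₁ s₀ * conj (a₂ s₀) * (𝓕 f s₀ * conj (𝓕 f s₀)) by ring] at h6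
  exact (mul_eq_zero.1 h6).resolve_right
    (mul_ne_zero h7 ((map_ne_zero _).2 h7))

end

/-! ### From pure point measures to pairs of coefficient families -/

section

variable {E : Type*} [NormedAddCommGroup E] [InnerProductSpace ℝ E] [FiniteDimensional ℝ E]
  [MeasurableSpace E] [BorelSpace E]

namespace SlowlyIncreasingMeasure

/-- The integral of a Schwartz function against a pure point measure is the absolutely convergent
sum over the atoms. -/
theorem IsPurePoint.summable_and_integral_eq_tsum {μ : SlowlyIncreasingMeasure E}
    (h : μ.IsPurePoint) (φ : 𝓢(E, ℂ)) :
    (Summable fun x => ‖μ.atom x * φ x‖) ∧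
      μ.toTemperedDistribution φ = ∑' x, μ.atom x * φ x := by
  have := μ.hasTemperateGrowth
  obtain ⟨A, hA, hA0⟩ := h
  have hint : Integrable (fun x => φ x * μ.phase x) μ.var :=
    (φ.integrable).mul_bdd (c := 1) μ.measurable_phase.aestronglyMeasurable
      (Eventually.of_forall fun x => (μ.norm_phase x).le)
  have hrestr : μ.var.restrict A = μ.var := Measure.restrict_eq_self_of_ae_mem hA0
  have hcount : Countable A := hA.to_subtype
  have hAU : ⋃ x : A, {(x : E)} = A := by ext; simp
  have hsup : Function.support (fun x => μ.atom x * φ x) ⊆ A := by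
    intro x hx
    by_contra hxA
    have : μ.var {x} = 0 := measure_mono_null (by simpa using hxA) hA0
    exact hx (by simp [atom, Measure.real, this])
  have key : ∀ {X : Type} [NormedAddCommGroup X] [NormedSpace ℝ X] [CompleteSpace X]
      (f : E → X), Integrable f μ.var →
      HasSum (fun x : A => μ.var.real {(x : E)} • f x) (∫ x, f x ∂μ.var) := by
    intro X _ _ _ f hf
    have h1 := hasSum_integral_iUnion (μ := μ.var) (f := f) (s := fun x : A => {(x : E)})
      (fun x => measurableSet_singleton _)
      (fun x y hxy => by simpa [Function.onFun] using fun h => hxy (Subtype.ext h))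
      hf.integrableOn
    rw [hAU, hrestr] at h1
    simpa [Measure.real] using h1
  constructor
  · have h1 := (key _ hint.norm).summable
    have h2 : Summable ((fun x => ‖μ.atom x * φ x‖) ∘ ((↑) : A → E)) := by
      refine h1.congr fun x => ?_
      simp [atom, μ.norm_phase, abs_of_nonneg measureReal_nonneg]
    have h3 : ∀ x ∉ range ((↑) : A → E), ‖μ.atom x * φ x‖ = 0 := by
      intro x hx
      rw [norm_eq_zero]
      by_contra hne
      exact hx (by simpa using hsup hne)
    exact (Subtype.val_injective.summable_iff h3).1 h2
  · rw [toTemperedDistribution_apply, ← (key _ hint).tsum_eq,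
      ← tsum_subtype_eq_of_support_subset hsup]
    refine tsum_congr fun x => ?_
    simp [atom]
    ring

/-- The dilation by `δ` normalizes the separation of `Λ - Λ`, and modulation by `char (-x₀)`
translates the spectrum by `-x₀`. The factor `δ ^ n`, with `n` the dimension, is the Jacobian. -/
theorem HasFourierTransform.fourierPair {μ ν : SlowlyIncreasingMeasure E}
    (h : μ.HasFourierTransform ν) (hμ : μ.IsPurePoint) (hν : ν.IsPurePoint) {δ : ℝ} (hδ : 0 < δ)
    (x₀ : E) :
    FourierPair (fun l => μ.atom (δ • l) * char (-x₀) l)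
      (fun s => (δ ^ Module.finrank ℝ E : ℝ) * ν.atom (δ⁻¹ • (s + x₀))) := by
  intro φ hφ hφc
  let e₁ : E ≃ E := (Homeomorph.smulOfNeZero δ hδ.ne').toEquiv
  let e₂ : E ≃ E := (Equiv.addRight x₀).trans (Homeomorph.smulOfNeZero δ⁻¹
    (inv_ne_zero hδ.ne')).toEquiv
  have he₁ : ∀ l, e₁ l = δ • l := fun l => rfl
  have he₂ : ∀ s, e₂ s = δ⁻¹ • (s + x₀) := fun s => rfl
  let hom : E → E ≃ₜ E := fun y => (Homeomorph.smulOfNeZero δ⁻¹ (inv_ne_zero hδ.ne')).trans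
    (Homeomorph.subLeft y)
  let g : E → E → ℂ := fun y x => char (-x₀) (δ⁻¹ • x) * φ (y - δ⁻¹ • x)
  have hg : ∀ y, ContDiff ℝ ∞ (g y) := fun y =>
    ((contDiff_char (-x₀)).comp (contDiff_const_smul δ⁻¹)).mul
      (hφ.comp (contDiff_const.sub (contDiff_const_smul δ⁻¹)))
  have hgc : ∀ y, HasCompactSupport (g y) := fun y =>
    (hφc.comp_homeomorph (hom y)).mul_left
  let f : E → 𝓢(E, ℂ) := fun y => (hgc y).toSchwartzMap (hg y)
  have hf : ∀ y x, f y x = g y x := fun y x => rfl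
  have hinv : ∀ y s, (𝓕⁻ (f y)) (e₂ s) = (δ ^ Module.finrank ℝ E : ℝ) * (𝓕 φ s * char s y) := by
    intro y s
    rw [SchwartzMap.fourierInv_coe, fourierInv_eq_integral_char]
    have h1 : ∀ x, char (e₂ s) x * f y x = (fun u => char s u * φ (y - u)) (δ⁻¹ • x) := by
      intro x
      rw [hf, he₂, char_smul_left, char_add_left]
      calc char s (δ⁻¹ • x) * char x₀ (δ⁻¹ • x) * (char (-x₀) (δ⁻¹ • x) * φ (y - δ⁻¹ • x))
          = char s (δ⁻¹ • x) * (char x₀ (δ⁻¹ • x) * char (-x₀) (δ⁻¹ • x)) *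
              φ (y - δ⁻¹ • x) := by ring
        _ = _ := by rw [char_mul_char_neg, mul_one]
    rw [integral_congr_ae (Eventually.of_forall h1), 
      Measure.integral_comp_inv_smul_of_nonneg volume (fun u => char s u * φ (y - u)) hδ.le,
      Complex.real_smul,
      ← integral_sub_left_eq_self _ volume y]
    congr 1
    rw [fourier_eq_integral_char, ← integral_mul_const]
    refine integral_congr_ae (Eventually.of_forall fun u => ?_)
    simp only [sub_sub_cancel]
    rw [sub_eq_add_neg, char_add_right, ← char_neg_left]
    ring
  have hpair : ∀ y, ∑' x, μ.atom x * f y x = ∑' s, ν.atom s * (𝓕⁻ (f y)) s := by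
    intro y
    rw [← (hμ.summable_and_integral_eq_tsum (f y)).2,
      ← (hν.summable_and_integral_eq_tsum (𝓕⁻ (f y))).2, ← show _ = _ from h,
      TemperedDistribution.fourier_apply, FourierTransform.fourier_fourierInv_eq]
  refine ⟨?_, fun y => ?_⟩
  · have h1 := (hν.summable_and_integral_eq_tsum (𝓕⁻ (f 0))).1
    refine ((e₂.summable_iff).2 h1).congr fun s => ?_
    rw [Function.comp_apply, hinv, he₂, char_zero_right]
    congr 1
    ring
  · calc comb (fun l => μ.atom (δ • l) * char (-x₀) l) φ y
        = ∑' l, μ.atom (e₁ l) * f y (e₁ l) := by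
          refine tsum_congr fun l => ?_
          rw [hf, he₁]
          simp only [g, smul_smul, inv_mul_cancel₀ hδ.ne', one_smul]
          ring
      _ = ∑' s, ν.atom (e₂ s) * (𝓕⁻ (f y)) (e₂ s) := by
          rw [e₁.tsum_eq (fun x => μ.atom x * f y x), hpair,
            e₂.tsum_eq (fun s => ν.atom s * (𝓕⁻ (f y) : 𝓢(E, ℂ)) s)]
      _ = _ := by
          refine tsum_congr fun s => ?_
          rw [hinv, he₂]
          ring

end SlowlyIncreasingMeasure

end

/-! ### Geometry of Meyer sets and the conclusion -/

theorem einfsep_pos_iff_exists_dist {X : Type*} [PseudoMetricSpace X] {s : Set X} :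
    0 < s.einfsep ↔ ∃ ε : ℝ, 0 < ε ∧ ∀ x ∈ s, ∀ y ∈ s, x ≠ y → ε ≤ dist x y := by
  constructor
  · intro h
    obtain ⟨c, hc, hc'⟩ := einfsep_pos.1 h
    refine ⟨(min c 1).toReal, ENNReal.toReal_pos (by positivity) (by simp), fun x hx y hy hxy => ?_⟩
    rw [dist_edist]
    exact ENNReal.toReal_mono (edist_ne_top _ _) ((min_le_left _ _).trans (hc' x hx y hy hxy))
  · rintro ⟨ε, hε, h⟩
    exact (ENNReal.ofReal_pos.2 hε).trans_le (le_einfsep_of_forall_dist_le h)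

/-- A difference of two elements of `Λ - Λ` lies in `Λ + (F + F - F)`, a finite union of translates
of `Λ`. Each translate has at most one point within `ε / 2` of the origin, so its non-zero points
stay away from it. -/
theorem IsMeyer.einfsep_sub_pos {E : Type*} [NormedAddCommGroup E] {Λ : Set E} (h : IsMeyer Λ) :
    0 < (Λ - Λ).einfsep := by
  obtain ⟨⟨hud, -⟩, F, hF, hsub⟩ := h
  obtain ⟨ε, hε, hΛ⟩ := einfsep_pos_iff_exists_dist.1 hud
  have hfin : (F + F - F).Finite := (hF.add hF).sub hF
  have h1 : ∀ f ∈ F + F - F, ∀ᶠ c : ℝ in 𝓝[>] 0, ∀ l ∈ Λ, l + f ≠ 0 → c ≤ ‖l + f‖ := by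
    intro f _
    by_cases hex : ∃ l ∈ Λ, l + f ≠ 0 ∧ ‖l + f‖ < ε / 2
    · obtain ⟨l, hl, hne, hlt⟩ := hex
      filter_upwards [Ioo_mem_nhdsGT (norm_pos_iff.2 hne)] with c hc l' hl' _
      by_cases hll : l = l'
      · rw [← hll]; exact hc.2.le
      · have h2 := hΛ l hl l' hl' hll
        have h3 : dist l l' ≤ ‖l + f‖ + ‖l' + f‖ := by
          rw [dist_eq_norm, show l - l' = (l + f) - (l' + f) by abel]
          exact norm_sub_le _ _
        linarith [hc.2]
    · push Not at hex
      filter_upwards [Ioo_mem_nhdsGT (half_pos hε)] with c hc l hl hne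
      exact hc.2.le.trans (hex l hl hne)
  have h2 := (eventually_all_finite hfin).2 h1
  obtain ⟨c, hc, hc0⟩ := (h2.and self_mem_nhdsWithin).exists
  refine einfsep_pos_iff_exists_dist.2 ⟨c, hc0, fun x hx y hy hxy => ?_⟩
  obtain ⟨l, hl, f, hf, rfl⟩ := hsub hx
  obtain ⟨l', hl', f', hf', rfl⟩ := hsub hy
  obtain ⟨l'', hl'', f'', hf'', he⟩ := hsub (sub_mem_sub hl hl')
  have he : l'' + f'' = l - l' := he
  have h3 : (l + f) - (l' + f') = l'' + (f'' + f - f') := by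
    rw [show (l + f) - (l' + f') = (l - l') + (f - f') by abel, ← he]; abel
  rw [dist_eq_norm]
  change c ≤ ‖(l + f) - (l' + f')‖
  rw [h3]
  exact hc _ (sub_mem_sub (add_mem_add hf'' hf) hf') l'' hl'' (h3 ▸ sub_ne_zero.2 hxy)

theorem IsRelativelyDense.nontrivial {E : Type*} [NormedAddCommGroup E] [NormedSpace ℝ E]
    [Nontrivial E] {Λ : Set E} (h : IsRelativelyDense Λ) : Λ.Nontrivial := by
  obtain ⟨R, hR, h⟩ := h
  obtain ⟨l, -, hl⟩ := h 0
  obtain ⟨z, hz⟩ := NormedSpace.exists_lt_norm ℝ E R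
  obtain ⟨l', hl', hl'Λ⟩ := h (l + z)
  refine ⟨l, hl, l', hl'Λ, ?_⟩
  rintro rfl
  rw [mem_ball, dist_eq_norm, sub_add_cancel_left, norm_neg] at hl'
  exact absurd hz (not_lt.2 hl'.le)

theorem exists_infinite_ball_inter_support (E : Type u) [NormedAddCommGroup E]
    [InnerProductSpace ℝ E] [FiniteDimensional ℝ E] [MeasurableSpace E] [BorelSpace E] :
    ∃ C : ℝ, 0 < C ∧ ∀ μ ν : SlowlyIncreasingMeasure E, μ.IsPurePoint → ν.IsPurePoint →
      μ.HasFourierTransform ν → ∀ δ : ℝ, 0 < δ →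
      (∀ p ∈ μ.support - μ.support, ∀ q ∈ μ.support - μ.support, p ≠ q → δ ≤ dist p q) →
      ¬ IsUniformlyDiscrete ν.support → ∀ x : E, (ball x (C / δ) ∩ ν.support).Infinite := by
  obtain ⟨C, hC, hcore⟩ := exists_radius E
  -- The radius doubles because one point of the recurring pair lies within `C / δ` of `x` and the
  -- other is displaced by less than `C / δ`.
  refine ⟨2 * C, by positivity, fun μ ν hμ hν hF δ hδ hsep hnud x hfin => ?_⟩
  obtain ⟨ε, hε, hεT⟩ := einfsep_pos_iff_exists_dist.1 hfin.einfsep_pos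
  have hpair : ∃ s ∈ ν.support, ∃ s' ∈ ν.support, s ≠ s' ∧ dist s s' < min ε (C / δ) := by
    by_contra! hcon
    exact hnud (einfsep_pos_iff_exists_dist.2 ⟨min ε (C / δ), by positivity, hcon⟩)
  obtain ⟨s, hs, s', hs', hne, hdist⟩ := hpair
  have hDS : DiffSeparated {l | δ • l ∈ μ.support} := by
    rintro _ ⟨p, hp, p', hp', rfl⟩ _ ⟨q, hq, q', hq', rfl⟩ hpq
    have h1 := hsep _ (sub_mem_sub hp hp') _ (sub_mem_sub hq hq') (by
      intro h
      rw [← smul_sub, ← smul_sub] at h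
      exact hpq (smul_right_injective E hδ.ne' h))
    rw [dist_eq_norm, ← smul_sub, ← smul_sub, ← smul_sub, norm_smul, Real.norm_of_nonneg hδ.le]
      at h1
    exact le_of_mul_le_mul_left (by simpa using h1) hδ
  have hsupp : ∀ x₀ : E, Function.support (fun l => μ.atom (δ • l) * char (-x₀) l) ⊆
      {l | δ • l ∈ μ.support} := fun x₀ l hl => left_ne_zero_of_mul hl
  have hnz : ((δ ^ Module.finrank ℝ E : ℝ) : ℂ) ≠ 0 := by
    exact_mod_cast (pow_pos hδ _).ne'
  -- With these shifts the product at `t` is non-zero exactly when `δ⁻¹ • t + x` and `δ⁻¹ • t + x -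
  -- (s - s')` are both in `ν.support`.
  have hcon := mt (hcore _ _ _ _ _ hDS (hsupp (δ • x)) (hsupp (δ • (x - (s - s'))))
    (hF.fourierPair hμ hν hδ _) (hF.fourierPair hμ hν hδ _))
  have h1 : ∃ t, ‖t‖ < C ∧ ((δ ^ Module.finrank ℝ E : ℝ) * ν.atom (δ⁻¹ • (t + δ • x))) *
      conj ((δ ^ Module.finrank ℝ E : ℝ) * ν.atom (δ⁻¹ • (t + δ • (x - (s - s'))))) ≠ 0 := by
    by_contra! h
    refine hcon (fun h' => ?_) h
    -- At this frequency the two points are `s` and `s'`, so the product is not identically zero.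
    have h2 := h' (δ • (s - x))
    rw [← smul_add, ← smul_add, inv_smul_smul₀ hδ.ne', inv_smul_smul₀ hδ.ne',
      show s - x + x = s by abel, show s - x + (x - (s - s')) = s' by abel] at h2
    exact mul_ne_zero (mul_ne_zero hnz hs) ((map_ne_zero _).2 (mul_ne_zero hnz hs')) h2
  obtain ⟨t, ht, h0⟩ := h1
  have hp : ν.atom (δ⁻¹ • (t + δ • x)) ≠ 0 := right_ne_zero_of_mul (left_ne_zero_of_mul h0)
  have hq : ν.atom (δ⁻¹ • (t + δ • (x - (s - s')))) ≠ 0 :=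
    right_ne_zero_of_mul ((map_ne_zero _).1 (right_ne_zero_of_mul h0))
  rw [smul_add, inv_smul_smul₀ hδ.ne'] at hp hq
  have htn : ‖δ⁻¹ • t‖ < C / δ := by
    rw [norm_smul, norm_inv, Real.norm_of_nonneg hδ.le, ← div_eq_inv_mul]
    gcongr
  have hlt := lt_min_iff.1 hdist
  rw [dist_eq_norm] at hlt
  have h2C : 2 * C / δ = C / δ + C / δ := by ring
  have hpq : dist (δ⁻¹ • t + x) (δ⁻¹ • t + (x - (s - s'))) = ‖s - s'‖ := by
    rw [dist_eq_norm]; congr 1; abel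
  have hpb : δ⁻¹ • t + x ∈ ball x (2 * C / δ) := by
    rw [mem_ball, dist_eq_norm, add_sub_cancel_right, h2C]
    have : 0 < C / δ := by positivity
    linarith
  have hqb : δ⁻¹ • t + (x - (s - s')) ∈ ball x (2 * C / δ) := by
    rw [mem_ball, dist_eq_norm, show δ⁻¹ • t + (x - (s - s')) - x = δ⁻¹ • t - (s - s') by abel, h2C]
    exact (norm_sub_le _ _).trans_lt (by linarith)
  have h3 := hεT _ ⟨hpb, hp⟩ _ ⟨hqb, hq⟩ (by
    rw [← dist_pos, hpq]; exact norm_pos_iff.2 (sub_ne_zero.2 hne))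
  rw [hpq] at h3
  linarith [hlt.1]

theorem isRelativelyDense_derivedSet {X : Type*} [PseudoMetricSpace X] [ProperSpace X] {S : Set X}
    {r : ℝ} (hr : 0 ≤ r) (h : ∀ x, (ball x r ∩ S).Infinite) :
    IsRelativelyDense (derivedSet S) := by
  -- The accumulation point may lie on the boundary sphere of radius `r`, hence the larger open
  -- ball.
  refine ⟨r + 1, by positivity, fun x => ?_⟩
  obtain ⟨z, hz, hacc⟩ := (h x).exists_accPt_of_subset_isCompact (isCompact_closedBall x r)
    (inter_subset_left.trans ball_subset_closedBall)
  exact ⟨z, closedBall_subset_ball (by linarith) hz,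
    hacc.mono (principal_mono.2 inter_subset_right)⟩

end Quasicrystal

end

theorem mainTheorem5 (n : ℕ) :
    ∃ C : ℝ, 0 < C ∧
      ∀ μ ν : Quasicrystal.SlowlyIncreasingMeasure (EuclideanSpace ℝ (Fin n)),
        μ.IsPurePoint → ν.IsPurePoint → μ.HasFourierTransform ν →
        Quasicrystal.IsMeyer μ.support →
        (Quasicrystal.IsUniformlyDiscrete ν.support ∨
          Quasicrystal.IsRelativelyDense (derivedSet ν.support)) ∧
        (¬ Quasicrystal.IsUniformlyDiscrete ν.support →
          ∀ x : EuclideanSpace ℝ (Fin n),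
            (Metric.ball x (C / (μ.support - μ.support).infsep) ∩ ν.support).Infinite) := by
  obtain ⟨C, hC, hmain⟩ :=
    Quasicrystal.exists_infinite_ball_inter_support (EuclideanSpace ℝ (Fin n))
  refine ⟨C, hC, fun μ ν hμ hν hF hM => ?_⟩
  have key : ¬ Quasicrystal.IsUniformlyDiscrete ν.support →
      ∀ x : EuclideanSpace ℝ (Fin n),
        (Metric.ball x (C / (μ.support - μ.support).infsep) ∩ ν.support).Infinite := by
    intro hnud
    -- For `n = 0` the real-valued `infsep` would take its default value `0`, but then every
    -- spectrum is uniformly discrete and the case does not arise.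
    have hnt : Nontrivial (EuclideanSpace ℝ (Fin n)) := by
      by_contra hcon
      rw [not_nontrivial_iff_subsingleton] at hcon
      exact hnud (by
        rw [Quasicrystal.IsUniformlyDiscrete, Set.subsingleton_of_subsingleton.einfsep]
        exact ENNReal.zero_lt_top)
    have hΛ := hM.1.2.nontrivial
    have hD : (μ.support - μ.support).Nontrivial := by
      obtain ⟨a, ha, b, hb, hab⟩ := hΛ
      exact ⟨a - a, Set.sub_mem_sub ha ha, b - a, Set.sub_mem_sub hb ha, by
        simpa [eq_comm, sub_eq_zero] using hab⟩
    have hpos : 0 < (μ.support - μ.support).infsep :=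
      Set.infsep_pos.2 ⟨hM.einfsep_sub_pos, Set.einfsep_lt_top_iff.2 hD⟩
    exact hmain μ ν hμ hν hF _ hpos
      (fun p hp q hq hpq => Set.infsep_le_dist_of_mem hp hq hpq) hnud
  refine ⟨?_, key⟩
  by_cases h : Quasicrystal.IsUniformlyDiscrete ν.support
  · exact Or.inl h
  · exact Or.inr (Quasicrystal.isRelativelyDense_derivedSet
      (div_nonneg hC.le Set.infsep_nonneg) (key h))
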